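/- For a nonempty set $S\subseteq[N]=\{1,\ldots,N\}$ write $|S\rangle:=\frac{1}{\sqrt{|S|}}\sum_{i\in S}|i\rangle$, and let $\mathcal{O}_S$ be the (controlled) membership oracle of $S$, which maps $|i,b\rangle$ to $(-1)^{b\cdot[i\in S]}|i,b\rangle$ for $i\in[N]$, $b\in\{0,1\}$. A quantum algorithm that receives $R$ copies of $|S\rangle$ and makes $T$ queries to $\mathcal{O}_S$ starts in the state $|S\rangle^{\otimes R}$ together with finitely many ancilla registers (including the registers for $i$ and $b$) in a fixed basis state, applies unitaries $U_0,\ldots,U_T$ that do not depend on $S$, with one application of $\mathcal{O}_S$ between $U_{t-1}$ and $U_t$ for each $t=1,\ldots,T$, and finally measures all registers in the computational basis and outputs one bit as a function of the measurement result. **Theorem.** There is an absolute constant $c>0$ such that the following holds for all integers $N,w\ge 1$ with $2w\le N$ and all integers $R,T\ge 0$. Let $Q$ be a quantum algorithm that receives $R$ copies of $|S\rangle$, makes $T$ queries to $\mathcal{O}_S$, and decides whether $|S|=w$ or $|S|=2w$ with success probability at least $2/3$, promised that one of those is the case (that is, for every $S\subseteq[N]$ with $|S|=w$ or $|S|=2w$,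 its output is correct with probability at least $2/3$). Then either $$T\ \ge\ c\sqrt{\frac{N}{w}}\qquad\text{or}\qquad R\ \ge\ c\,\min\left\{w^{1/4},\sqrt{\frac{N}{w}}\right\}.$$ -/

import Mathlib

open scoped Matrix

noncomputable section

/-- Computational basis of the registers of an algorithm: `R` registers that hold the input copies,
each with basis `[N]`, then an index register with basis `[N]`, a control qubit, and a workspace of
dimension `m`. -/
abbrev RegBasis (N R m : ℕ) : Type :=
  (Fin R → Fin N) × Fin N × Bool × Fin m

/-- The uniform superposition `|S⟩ = |S|^(-1/2) ∑_{i ∈ S} |i⟩`. -/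
def uniformState {N : ℕ} (S : Finset (Fin N)) : Fin N → ℂ :=
  fun i => if i ∈ S then ((1 / Real.sqrt (S.card : ℝ) : ℝ) : ℂ) else 0

/-- The tensor power `|S⟩^{⊗R}`. -/
def uniformCopies {N : ℕ} (R : ℕ) (S : Finset (Fin N)) : (Fin R → Fin N) → ℂ :=
  fun f => ∏ r, uniformState S (f r)

/-- One application of the membership oracle of `S`: the basis state `|f, i, b, z⟩` is multiplied
by `1 - 2 x_i = (-1)^{x_i}` if the control bit `b` is set, where `x` is the characteristic string
of `S`, and is left alone otherwise. (A Hadamard gate on the control qubit before and after turns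
this into `|i, b⟩ ↦ |i, b ⊕ x_i⟩`.) -/
def memberQuery {N R m : ℕ} (S : Finset (Fin N)) (ψ : RegBasis N R m → ℂ) :
    RegBasis N R m → ℂ :=
  fun s => (if s.2.2.1 = true ∧ s.2.1 ∈ S then -1 else 1) * ψ s

/-- A quantum algorithm that receives `R` copies of `|S⟩` and makes `T` queries to the membership
oracle of `S ⊆ [N]`. The unitaries do not depend on `S` and act on all registers. At the end all
registers are measured in the computational basis, and `output` is applied to the result. -/
structure QuantumAlgorithm (N R T : ℕ) where
  /-- dimension of the workspace -/
  workDim : ℕ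
  /-- initial basis state of the index register, the control qubit and the workspace -/
  init : Fin N × Bool × Fin workDim
  /-- `U t` is applied after the `t`-th query and before the next one -/
  U : Fin (T + 1) → Matrix.unitaryGroup (RegBasis N R workDim) ℂ
  /-- the classical output as a function of the measurement result -/
  output : RegBasis N R workDim → Bool

namespace QuantumAlgorithm

variable {N R T : ℕ}

/-- The initial state `|S⟩^{⊗R} ⊗ |init⟩`. -/
def initialState (Q : QuantumAlgorithm N R T) (S : Finset (Fin N)) :
    RegBasis N R Q.workDim → ℂ :=
  fun s => uniformCopies R S s.1 * (if s.2 = Q.init then 1 else 0)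

/-- The state `U_t O_S U_{t-1} ⋯ U_1 O_S U_0 (|S⟩^{⊗R} ⊗ |init⟩)`. -/
def stateAfter (Q : QuantumAlgorithm N R T) (S : Finset (Fin N)) :
    (t : ℕ) → t < T + 1 → (RegBasis N R Q.workDim → ℂ)
  | 0, h => (Q.U ⟨0, h⟩).val *ᵥ Q.initialState S
  | t + 1, h =>
      (Q.U ⟨t + 1, h⟩).val *ᵥ memberQuery S (Q.stateAfter S t (Nat.lt_of_succ_lt h))

/-- The final state, after all `T` queries. -/
def finalState (Q : QuantumAlgorithm N R T) (S : Finset (Fin N)) :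
    RegBasis N R Q.workDim → ℂ :=
  Q.stateAfter S T (Nat.lt_succ_self T)

/-- The probability that the algorithm outputs `b` on `S`. -/
def outputProb (Q : QuantumAlgorithm N R T) (S : Finset (Fin N)) (b : Bool) : ℝ :=
  ∑ s with Q.output s = b, ‖Q.finalState S s‖ ^ 2

/-- The algorithm decides whether `|S| = w` (output `false`) or `|S| = 2w` (output `true`), promised
that one of those is the case, with success probability at least `2/3`. -/
def Decides (Q : QuantumAlgorithm N R T) (w : ℕ) : Prop :=
  (∀ S : Finset (Fin N), S.card = w → 2 / 3 ≤ Q.outputProb S false) ∧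
    (∀ S : Finset (Fin N), S.card = 2 * w → 2 / 3 ≤ Q.outputProb S true)

end QuantumAlgorithm

end

/-! The proof is the polynomial method with Laurent polynomials. Each final amplitude is
`|S|^(-R/2)` times a polynomial of degree at most `R + T` in the characteristic string of `S`: a
copy contributes a membership indicator and a normalization, a query a factor of degree at most one.
Hence the acceptance probability `q k`, averaged over `|S| = k`, satisfies `k^R * q k = P k` for `1
≤ k ≤ N` with `deg P ≤ 2 (R + T)` (`exists_polynomial_averageProb`), while `0 ≤ q ≤ 1`, `q w ≤ 1/3`
and `q (2w) ≥ 2/3`.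

`not_separated_of_laurent` refutes this with an explicit dual certificate. Take `2 (R + T) + 2`
integer nodes: `w`, `2w`, `R` nodes `⌊w / (64 j²)⌋` and `R + 2T` nodes `64 w j²`. The divided
difference of `k^R (q k - 1/2)` over them vanishes. Its terms at `w` and `2w` have the same sign,
because `q - 1/2` and the nodal product both change sign between these points. The other terms
cannot cancel them: the weight of the `j`-th small (large) node is at most `3 / (64 j²)` times that
of `w` (of `2w`), by `node_small_weight_le` and `node_large_weight_le`. Behind this is the bound
`∏_{i ≠ j} i² / |j² - i²| ≤ 2` for quadratically spaced points. The small nodes must stay well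
separated after rounding, which needs `w ≥ 128 R⁴`; the large ones must not exceed `N`, which needs
`64 w (R + 2T)² ≤ N`. These conditions produce the bounds of the theorem. -/

/-! ### Polynomials in the characteristic string and their averages -/

/-- The indicator of `A ⊆ S`, as a function of `S`. -/
def subsetIndicator {N : ℕ} (A : Finset (Fin N)) : Finset (Fin N) → ℂ :=
  fun S => if A ⊆ S then 1 else 0

/-- Functions of `S` that are polynomials of degree at most `d` in the characteristic string. -/
def subsetPolys (N d : ℕ) : Submodule ℂ (Finset (Fin N) → ℂ) :=
  Submodule.span ℂ {f | ∃ A : Finset (Fin N), A.card ≤ d ∧ f = subsetIndicator A}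

theorem subsetIndicator_mem_subsetPolys {N d : ℕ} (A : Finset (Fin N)) (hA : A.card ≤ d) :
    subsetIndicator A ∈ subsetPolys N d :=
  Submodule.subset_span ⟨A, hA, rfl⟩

theorem subsetIndicator_mul {N : ℕ} (A B : Finset (Fin N)) :
    subsetIndicator A * subsetIndicator B = subsetIndicator (A ∪ B) := by
  funext S
  simp only [subsetIndicator, Pi.mul_apply, Finset.union_subset_iff]
  split_ifs <;> simp_all

theorem mul_mem_subsetPolys {N a b : ℕ} {f g : Finset (Fin N) → ℂ}
    (hf : f ∈ subsetPolys N a) (hg : g ∈ subsetPolys N b) : f * g ∈ subsetPolys N (a + b) := by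
  induction hf using Submodule.span_induction with
  | mem f hf =>
    obtain ⟨A, hA, rfl⟩ := hf
    induction hg using Submodule.span_induction with
    | mem g hg =>
      obtain ⟨B, hB, rfl⟩ := hg
      rw [subsetIndicator_mul]
      exact subsetIndicator_mem_subsetPolys _
        ((Finset.card_union_le _ _).trans (add_le_add hA hB))
    | zero => rw [mul_zero]; exact Submodule.zero_mem _
    | add g h _ _ hg hh => rw [mul_add]; exact Submodule.add_mem _ hg hh
    | smul c g _ hg => rw [mul_smul_comm]; exact Submodule.smul_mem _ _ hg
  | zero => rw [zero_mul]; exact Submodule.zero_mem _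
  | add f h _ _ hf hh => rw [add_mul]; exact Submodule.add_mem _ hf hh
  | smul c f _ hf => rw [smul_mul_assoc]; exact Submodule.smul_mem _ _ hf

theorem star_mem_subsetPolys {N d : ℕ} {f : Finset (Fin N) → ℂ}
    (hf : f ∈ subsetPolys N d) : star f ∈ subsetPolys N d := by
  induction hf using Submodule.span_induction with
  | mem f hf =>
    obtain ⟨A, hA, rfl⟩ := hf
    convert subsetIndicator_mem_subsetPolys A hA using 1
    funext S
    simp only [Pi.star_apply, subsetIndicator]
    split_ifs <;> simp
  | zero => rw [star_zero]; exact Submodule.zero_mem _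
  | add f g _ _ hf hg => rw [star_add]; exact Submodule.add_mem _ hf hg
  | smul c f _ hf => rw [star_smul]; exact Submodule.smul_mem _ (star c) hf

theorem choose_mul_sum_subsetIndicator {N k : ℕ} (A : Finset (Fin N)) :
    (N.choose A.card : ℂ) * ∑ S ∈ Finset.powersetCard k Finset.univ, subsetIndicator A S =
      (N.choose k : ℂ) * (k.choose A.card : ℂ) := by
  unfold subsetIndicator
  rw [Finset.sum_boole]
  rcases le_or_gt A.card k with h | h
  · rw [Finset.card_filter_powersetCard_subset A _ k (Finset.subset_univ A) h, Finset.card_univ,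
      Fintype.card_fin]
    exact_mod_cast (Nat.choose_mul h).symm
  · rw [Nat.choose_eq_zero_of_lt h, Finset.filter_false_of_mem]
    · simp
    · intro S hS hAS
      have := Finset.card_le_card hAS
      rw [(Finset.mem_powersetCard.1 hS).2] at this
      omega

/-- The average over the sets of size `k` of a polynomial of degree `d` in the characteristic
string is a polynomial of degree `d` in `k`. -/
theorem exists_polynomial_average {N d : ℕ} {f : Finset (Fin N) → ℂ} (hf : f ∈ subsetPolys N d) :
    ∃ P : Polynomial ℂ, P.natDegree ≤ d ∧ ∀ k : ℕ,
      ∑ S ∈ Finset.powersetCard k Finset.univ, f S = (N.choose k : ℂ) * P.eval (k : ℂ) := by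
  induction hf using Submodule.span_induction with
  | mem f hf =>
    obtain ⟨A, hA, rfl⟩ := hf
    -- With `a = |A|`, a random `k`-set contains `A` with probability `C(k,a) / C(N,a)`, and
    -- `C(k,a)` is a falling factorial in `k` over `a!`.
    refine ⟨Polynomial.C (((N.choose A.card : ℕ) : ℂ)⁻¹ * ((A.card.factorial : ℕ) : ℂ)⁻¹) *
      descPochhammer ℂ A.card, ?_, fun k => ?_⟩
    · exact (Polynomial.natDegree_C_mul_le _ _).trans (by simpa using hA)
    · have h1 := choose_mul_sum_subsetIndicator (k := k) A
      have h2 : ((N.choose A.card : ℕ) : ℂ) ≠ 0 := by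
        have := Nat.choose_pos (Finset.card_le_univ A |>.trans_eq (Fintype.card_fin N))
        exact_mod_cast this.ne'
      have h3 : ((A.card.factorial : ℕ) : ℂ) ≠ 0 := by exact_mod_cast Nat.factorial_ne_zero _
      rw [Polynomial.eval_mul, Polynomial.eval_C, descPochhammer_eval_eq_descFactorial,
        Nat.descFactorial_eq_factorial_mul_choose]
      apply mul_left_cancel₀ h2
      rw [h1]
      push_cast
      field_simp
  | zero => exact ⟨0, by simp, by simp⟩
  | add f g _ _ hf hg =>
    obtain ⟨P, hP, hP'⟩ := hf
    obtain ⟨Q, hQ, hQ'⟩ := hg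
    refine ⟨P + Q, (Polynomial.natDegree_add_le _ _).trans (max_le hP hQ), fun k => ?_⟩
    simp [Finset.sum_add_distrib, hP', hQ', mul_add]
  | smul c f _ hf =>
    obtain ⟨P, hP, hP'⟩ := hf
    refine ⟨Polynomial.C c * P, (Polynomial.natDegree_C_mul_le _ _).trans hP, fun k => ?_⟩
    simp only [Pi.smul_apply, smul_eq_mul, ← Finset.mul_sum, hP', Polynomial.eval_mul,
      Polynomial.eval_C]
    ring

/-! ### Normalization of the states -/

theorem sum_norm_sq_mulVec_unitary {ι : Type*} [Fintype ι] [DecidableEq ι]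
    (U : Matrix.unitaryGroup ι ℂ) (ψ : ι → ℂ) :
    ∑ s, ‖(U.val *ᵥ ψ) s‖ ^ 2 = ∑ s, ‖ψ s‖ ^ 2 := by
  have key : ∀ φ : ι → ℂ, ((∑ s, ‖φ s‖ ^ 2 : ℝ) : ℂ) = star φ ⬝ᵥ φ := fun φ => by
    simp [dotProduct, ← Complex.conj_mul']
  apply Complex.ofReal_injective
  rw [key, key, Matrix.star_mulVec, Matrix.dotProduct_mulVec, Matrix.vecMul_vecMul,
    ← Matrix.star_eq_conjTranspose, Unitary.star_mul_self_of_mem U.2, Matrix.vecMul_one]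

theorem sum_norm_sq_memberQuery {N R m : ℕ} (S : Finset (Fin N)) (ψ : RegBasis N R m → ℂ) :
    ∑ s, ‖memberQuery S ψ s‖ ^ 2 = ∑ s, ‖ψ s‖ ^ 2 := by
  refine Finset.sum_congr rfl fun s _ => ?_
  unfold memberQuery
  split_ifs <;> simp

theorem sum_norm_sq_uniformState {N : ℕ} {S : Finset (Fin N)} (hS : S.Nonempty) :
    ∑ i, ‖uniformState S i‖ ^ 2 = 1 := by
  have h : (S.card : ℝ) ≠ 0 := by exact_mod_cast hS.card_pos.ne'
  have (i : Fin N) : ‖uniformState S i‖ ^ 2 = if i ∈ S then (S.card : ℝ)⁻¹ else 0 := by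
    unfold uniformState
    split_ifs <;> simp
  simp [this, h]

theorem sum_norm_sq_uniformCopies {N R : ℕ} {S : Finset (Fin N)} (hS : S.Nonempty) :
    ∑ f, ‖uniformCopies R S f‖ ^ 2 = 1 := by
  have := Fintype.sum_pow (fun i => ‖uniformState S i‖ ^ 2) R
  rw [sum_norm_sq_uniformState hS, one_pow] at this
  simp [uniformCopies, ← Finset.prod_pow, this]

namespace QuantumAlgorithm

variable {N R T : ℕ}

theorem sum_norm_sq_initialState (Q : QuantumAlgorithm N R T) {S : Finset (Fin N)}
    (hS : S.Nonempty) : ∑ s, ‖Q.initialState S s‖ ^ 2 = 1 := by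
  rw [Fintype.sum_prod_type, ← sum_norm_sq_uniformCopies (R := R) hS]
  refine Finset.sum_congr rfl fun f _ => ?_
  rw [Finset.sum_eq_single Q.init]
  · simp [initialState]
  · intro b _ hb
    simp [initialState, hb]
  · simp

theorem sum_norm_sq_stateAfter (Q : QuantumAlgorithm N R T) {S : Finset (Fin N)}
    (hS : S.Nonempty) (t : ℕ) (ht : t < T + 1) : ∑ s, ‖Q.stateAfter S t ht s‖ ^ 2 = 1 := by
  induction t with
  | zero => rw [stateAfter, sum_norm_sq_mulVec_unitary, Q.sum_norm_sq_initialState hS]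
  | succ t ih => rw [stateAfter, sum_norm_sq_mulVec_unitary, sum_norm_sq_memberQuery, ih]

theorem outputProb_nonneg (Q : QuantumAlgorithm N R T) (S : Finset (Fin N)) (b : Bool) :
    0 ≤ Q.outputProb S b :=
  Finset.sum_nonneg fun _ _ => by positivity

theorem outputProb_false_add_true (Q : QuantumAlgorithm N R T) {S : Finset (Fin N)}
    (hS : S.Nonempty) : Q.outputProb S false + Q.outputProb S true = 1 := by
  have := Finset.sum_filter_add_sum_filter_not Finset.univ (fun s => Q.output s = false)
    (fun s => ‖Q.finalState S s‖ ^ 2)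
  simp only [Bool.not_eq_false] at this
  rw [outputProb, outputProb, this]
  exact Q.sum_norm_sq_stateAfter hS T (Nat.lt_succ_self T)

/-! ### Amplitudes and averaged probabilities as polynomials -/

/-- Unitaries only mix amplitudes linearly, so the degree grows at queries alone. The non-polynomial
normalization depends only on `|S|` and factors out. -/
theorem exists_stateAfter_eq (Q : QuantumAlgorithm N R T) (t : ℕ) (ht : t < T + 1) :
    ∃ g : RegBasis N R Q.workDim → Finset (Fin N) → ℂ, (∀ s, g s ∈ subsetPolys N (R + t)) ∧
      ∀ S s, Q.stateAfter S t ht s = ((1 / Real.sqrt (S.card : ℝ) : ℝ) : ℂ) ^ R * g s S := by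
  have unitary_step {d : ℕ} (M : Matrix (RegBasis N R Q.workDim) (RegBasis N R Q.workDim) ℂ)
      (g : RegBasis N R Q.workDim → Finset (Fin N) → ℂ) (hg : ∀ s, g s ∈ subsetPolys N d) (s) :
      (∑ s', M s s' • g s') ∈ subsetPolys N d :=
    Submodule.sum_mem _ fun s' _ => Submodule.smul_mem _ _ (hg s')
  induction t with
  | zero =>
    refine ⟨_, unitary_step (Q.U ⟨0, ht⟩).val (fun s => (if s.2 = Q.init then (1 : ℂ) else 0) •
      subsetIndicator (Finset.univ.image s.1)) (fun s => ?_), fun S s => ?_⟩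
    · refine Submodule.smul_mem _ _ (subsetIndicator_mem_subsetPolys _ ?_)
      simpa using Finset.card_image_le (s := Finset.univ) (f := s.1)
    · rw [stateAfter, Matrix.mulVec, dotProduct, Finset.sum_apply, Finset.mul_sum]
      refine Finset.sum_congr rfl fun s' _ => ?_
      -- The product vanishes unless every entry of the tuple lies in `S`; otherwise its `R` factors
      -- are equal.
      have : uniformCopies R S s'.1 = ((1 / Real.sqrt (S.card : ℝ) : ℝ) : ℂ) ^ R *
          subsetIndicator (Finset.univ.image s'.1) S := by
        unfold uniformCopies uniformState subsetIndicator
        split_ifs with h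
        · rw [Finset.prod_congr rfl fun r _ => if_pos (h (Finset.mem_image_of_mem _ (Finset.mem_univ r)))]
          simp
        · rw [Finset.image_subset_iff] at h
          push Not at h
          obtain ⟨r, _, hr⟩ := h
          rw [Finset.prod_eq_zero (Finset.mem_univ r) (if_neg hr), mul_zero]
      simp only [initialState, this, Pi.smul_apply, smul_eq_mul]
      ring
  | succ t ih =>
    obtain ⟨g, hg, hgS⟩ := ih (Nat.lt_of_succ_lt ht)
    -- The phase is `1 - 2 x_i` if the control bit is set and `1` otherwise; the constant `1` is the
    -- indicator of `∅ ⊆ S`.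
    refine ⟨_, unitary_step (Q.U ⟨t + 1, ht⟩).val (fun s => g s *
      if s.2.2.1 = true then subsetIndicator ∅ + (-2 : ℂ) • subsetIndicator {s.2.1}
        else subsetIndicator ∅) (fun s => ?_), fun S s => ?_⟩
    · rw [← add_assoc]
      refine mul_mem_subsetPolys (hg s) ?_
      have h1 : subsetIndicator ∅ ∈ subsetPolys N 1 :=
        subsetIndicator_mem_subsetPolys ∅ (by simp)
      split_ifs
      · exact add_mem h1 (Submodule.smul_mem _ _ (subsetIndicator_mem_subsetPolys _ (by simp)))
      · exact h1
    · rw [stateAfter, Matrix.mulVec, dotProduct, Finset.sum_apply, Finset.mul_sum]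
      refine Finset.sum_congr rfl fun s' _ => ?_
      simp only [memberQuery, hgS, Pi.smul_apply, Pi.mul_apply, smul_eq_mul]
      by_cases h1 : s'.2.2.1 = true <;> by_cases h2 : s'.2.1 ∈ S <;>
        simp [h1, h2, subsetIndicator] <;> ring

/-- The average of the probability of output `b` over the sets of size `k`. -/
noncomputable def averageProb (Q : QuantumAlgorithm N R T) (b : Bool) (k : ℕ) : ℝ :=
  (∑ S ∈ Finset.powersetCard k Finset.univ, Q.outputProb S b) / (N.choose k : ℝ)

/-- `k ^ R` times the average acceptance probability is a polynomial in `k`. -/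
theorem exists_polynomial_averageProb (Q : QuantumAlgorithm N R T) (b : Bool) :
    ∃ P : Polynomial ℂ, P.natDegree ≤ 2 * (R + T) ∧ ∀ k : ℕ, 1 ≤ k → k ≤ N →
      P.eval (k : ℂ) = (k : ℂ) ^ R * (Q.averageProb b k : ℂ) := by
  obtain ⟨g, hg, hgS⟩ := Q.exists_stateAfter_eq T (Nat.lt_succ_self T)
  have hmem : (∑ s with Q.output s = b, star (g s) * g s) ∈ subsetPolys N (2 * (R + T)) := by
    rw [two_mul]
    exact Submodule.sum_mem _ fun s _ => mul_mem_subsetPolys (star_mem_subsetPolys (hg s)) (hg s)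
  obtain ⟨P, hP, hPk⟩ := exists_polynomial_average hmem
  refine ⟨P, hP, fun k hk hkN => ?_⟩
  have hN : (N.choose k : ℂ) ≠ 0 := by exact_mod_cast (Nat.choose_pos hkN).ne'
  apply mul_left_cancel₀ hN
  rw [← hPk, averageProb]
  push_cast
  rw [mul_left_comm, mul_div_cancel₀ _ hN, Finset.mul_sum]
  refine Finset.sum_congr rfl fun S hS => ?_
  obtain ⟨-, hS⟩ := Finset.mem_powersetCard.1 hS
  have hk0 : (0 : ℝ) < k := by exact_mod_cast hk
  rw [outputProb, Finset.sum_apply, Complex.ofReal_sum, Finset.mul_sum]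
  refine Finset.sum_congr rfl fun s _ => ?_
  -- The squared normalization `k^(-R)` cancels against `k^R`; this is where `k ≥ 1` matters, since
  -- `1 / √0 = 0` in Lean.
  have h1 : ((k : ℝ) ^ R) * (‖((1 / Real.sqrt (k : ℝ) : ℝ) : ℂ) ^ R‖ ^ 2) = 1 := by
    rw [norm_pow, Complex.norm_real, ← pow_mul, mul_comm R 2, pow_mul, Real.norm_eq_abs, sq_abs,
      div_pow, Real.sq_sqrt hk0.le, ← mul_pow]
    field_simp
    simp
  rw [finalState, hgS, hS, norm_mul, mul_pow, Complex.ofReal_mul, ← mul_assoc]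
  have h2 := congrArg (Complex.ofReal) h1
  push_cast at h2 ⊢
  rw [h2, one_mul, ← Complex.conj_mul']
  rfl

theorem averageProb_nonneg (Q : QuantumAlgorithm N R T) (b : Bool) (k : ℕ) :
    0 ≤ Q.averageProb b k :=
  div_nonneg (Finset.sum_nonneg fun S _ => Q.outputProb_nonneg S b) (by positivity)

theorem averageProb_false_add_true (Q : QuantumAlgorithm N R T) {k : ℕ} (hk : 1 ≤ k)
    (hkN : k ≤ N) : Q.averageProb false k + Q.averageProb true k = 1 := by
  have hN : (N.choose k : ℝ) ≠ 0 := by exact_mod_cast (Nat.choose_pos hkN).ne'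
  rw [averageProb, averageProb, ← add_div, ← Finset.sum_add_distrib, div_eq_one_iff_eq hN,
    Finset.sum_congr rfl fun S hS => Q.outputProb_false_add_true (Finset.card_pos.1
      (((Finset.mem_powersetCard.1 hS).2).symm ▸ hk))]
  simp

theorem le_averageProb (Q : QuantumAlgorithm N R T) {b : Bool} {k : ℕ} {x : ℝ} (hkN : k ≤ N)
    (h : ∀ S : Finset (Fin N), S.card = k → x ≤ Q.outputProb S b) : x ≤ Q.averageProb b k := by
  have hN : (0 : ℝ) < (N.choose k : ℝ) := by exact_mod_cast Nat.choose_pos hkN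
  rw [averageProb, le_div_iff₀ hN]
  have := Finset.card_nsmul_le_sum (Finset.powersetCard k Finset.univ) (fun S => Q.outputProb S b) x
    fun S hS => h S (Finset.mem_powersetCard.1 hS).2
  simpa [mul_comm] using this

end QuantumAlgorithm

/-! ### Products of differences of squares and of inverse squares -/

theorem prod_ite_one_mul {ι : Type*} [Fintype ι] [DecidableEq ι] (f : ι → ℝ) (j : ι) :
    (∏ i, if i = j then 1 else f i) * f j = ∏ i, f i := by
  rw [← Finset.mul_prod_erase _ f (Finset.mem_univ j),
    ← Finset.mul_prod_erase _ (fun i => if i = j then 1 else f i) (Finset.mem_univ j),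
    Finset.prod_congr rfl fun i hi => if_neg (Finset.ne_of_mem_erase hi)]
  simp [mul_comm]

/-- Log-convexity of the factorial, used with `a = c` for `m!² ≤ (m - a)! (m + a)!`. -/
theorem factorial_add_mul_factorial_add_le (l a c : ℕ) :
    (l + a).factorial * (l + c).factorial ≤ l.factorial * (l + a + c).factorial := by
  induction a with
  | zero => simp
  | succ a ih =>
    rw [← add_assoc, Nat.factorial_succ, show l + a + 1 + c = (l + a + c) + 1 by ring,
      Nat.factorial_succ]
    calc (l + a + 1) * (l + a).factorial * (l + c).factorial
        = (l + a + 1) * ((l + a).factorial * (l + c).factorial) := by ring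
      _ ≤ (l + a + c + 1) * (l.factorial * (l + a + c).factorial) :=
          Nat.mul_le_mul (by omega) ih
      _ = _ := by ring

theorem prod_range_sq_sub_sq_of_le (j k : ℕ) (h : k ≤ j) :
    (∏ i ∈ Finset.range k, if i = j then 1 else |((j : ℝ) + 1) ^ 2 - ((i : ℝ) + 1) ^ 2|) *
      ((j - k).factorial * (j + 1).factorial : ℝ) = j.factorial * (k + j + 1).factorial := by
  induction k with
  | zero => simp
  | succ k ih =>
    specialize ih (by omega)
    obtain ⟨d, rfl⟩ : ∃ d, j = k + 1 + d := ⟨j - (k + 1), by omega⟩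
    rw [Finset.prod_range_succ, if_neg (by omega)]
    rw [show k + 1 + d - k = d + 1 by omega, Nat.factorial_succ d] at ih
    rw [show k + 1 + d - (k + 1) = d by omega,
      show k + 1 + (k + 1 + d) + 1 = (k + (k + 1 + d) + 1) + 1 by ring, Nat.factorial_succ (k + _ + 1)]
    have : |(((k + 1 + d : ℕ) : ℝ) + 1) ^ 2 - ((k : ℝ) + 1) ^ 2| =
        ((d : ℝ) + 1) * (((k + (k + 1 + d) + 1 : ℕ) : ℝ) + 1) := by
      rw [abs_of_nonneg] <;> push_cast
      · ring
      · have : (0 : ℝ) ≤ d := by positivity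
        have : (0 : ℝ) ≤ k := by positivity
        nlinarith
    rw [this]
    push_cast at ih ⊢
    linear_combination ((k : ℝ) + (k + 1 + d) + 1 + 1) * ih

/-- Put `J = j + 1` and `m = J + l`. In `|J² - I²| = |J - I| (J + I)` the differences multiply to
`(J - 1)! l!` and the sums to `(m + J)! / (J! * 2J)`. -/
theorem prod_range_sq_sub_sq (j l : ℕ) :
    2 * ((j : ℝ) + 1) ^ 2 * (∏ i ∈ Finset.range (j + 1 + l),
      if i = j then 1 else |((j : ℝ) + 1) ^ 2 - ((i : ℝ) + 1) ^ 2|) =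
      l.factorial * (2 * j + 2 + l).factorial := by
  induction l with
  | zero =>
    have h := prod_range_sq_sub_sq_of_le j j le_rfl
    rw [add_zero, Finset.prod_range_succ, if_pos rfl, mul_one, add_zero,
      Nat.factorial_succ (2 * j + 1)]
    rw [Nat.sub_self, Nat.factorial_succ j, show j + j + 1 = 2 * j + 1 by ring] at h
    have hj : ((j.factorial : ℕ) : ℝ) ≠ 0 := by exact_mod_cast j.factorial_ne_zero
    apply mul_left_cancel₀ hj
    push_cast at h ⊢
    simp only [Nat.factorial_zero, Nat.cast_one] at h ⊢
    linear_combination 2 * ((j : ℝ) + 1) * h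
  | succ l ih =>
    rw [← add_assoc, Finset.prod_range_succ, if_neg (by omega), ← add_assoc,
      Nat.factorial_succ l, Nat.factorial_succ (2 * j + 2 + l), ← mul_assoc, ih]
    have : |((j : ℝ) + 1) ^ 2 - (((j + 1 + l : ℕ) : ℝ) + 1) ^ 2| =
        ((l : ℝ) + 1) * (((2 * j + 2 + l : ℕ) : ℝ) + 1) := by
      rw [abs_of_nonpos] <;> push_cast
      · ring
      · have : (0 : ℝ) ≤ l := by positivity
        have : (0 : ℝ) ≤ j := by positivity
        nlinarith
    rw [this]
    push_cast
    ring

/-- With `J = j + 1`, the ratio of the two products is exactly `2 m!² / ((m - J)! (m + J)!)`. -/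
theorem prod_sq_le_two_mul_prod_sq_sub_sq {m : ℕ} (j : Fin m) :
    (∏ i : Fin m, if i = j then (1 : ℝ) else ((i : ℝ) + 1) ^ 2) ≤
      2 * ∏ i : Fin m, if i = j then 1 else |((j : ℝ) + 1) ^ 2 - ((i : ℝ) + 1) ^ 2| := by
  obtain ⟨l, hl⟩ : ∃ l, m = j + 1 + l := ⟨m - (j + 1), by omega⟩
  have h1 := prod_ite_one_mul (fun i : Fin m => ((i : ℝ) + 1) ^ 2) j
  have h2 := prod_range_sq_sub_sq j l
  rw [← hl, Finset.prod_range] at h2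
  simp only [Fin.val_inj] at h2
  have h3 : (∏ i : Fin m, ((i : ℝ) + 1) ^ 2) = (m.factorial : ℝ) ^ 2 := by
    rw [Finset.prod_pow, ← Finset.prod_range (fun i => (i : ℝ) + 1),
      ← Finset.prod_range_add_one_eq_factorial]
    push_cast
    rfl
  have h4 : (m.factorial : ℝ) ^ 2 ≤ l.factorial * (2 * j + 2 + l).factorial := by
    have := factorial_add_mul_factorial_add_le l (j + 1) (j + 1)
    rw [show l + ((j : ℕ) + 1) = m by omega, show m + ((j : ℕ) + 1) = 2 * j + 2 + l by omega] at this
    rw [sq]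
    exact_mod_cast this
  have h5 : (0 : ℝ) < ((j : ℝ) + 1) ^ 2 := by positivity
  refine le_of_mul_le_mul_right ?_ h5
  rw [h1, h3]
  refine h4.trans (h2.symm.le.trans_eq (by ring))

theorem sum_inv_sq_le_two (n : ℕ) : ∑ j : Fin n, (((j : ℝ) + 1) ^ 2)⁻¹ ≤ 2 := by
  have h := sum_Ioo_inv_sq_le (α := ℝ) 0 (n + 1)
  rw [← Finset.sum_range (fun j => (((j : ℝ) + 1) ^ 2)⁻¹)]
  refine le_trans (le_of_eq ?_) (h.trans_eq (by norm_num))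
  refine Finset.sum_nbij (· + 1) (by simp) (by simp) (fun i hi => ?_) (by simp)
  simp only [Finset.coe_Ioo, Set.mem_Ioo] at hi
  exact ⟨i - 1, by simp; omega, by simp; omega⟩

/-! ### The interpolation nodes and their weights -/

/-- The interpolation nodes: `w`, `2 w`, points `w / (64 j²)` below `w` and `64 w j²` above `2 w`. -/
def node (w n m : ℕ) : Bool ⊕ (Fin n ⊕ Fin m) → ℕ
  | .inl false => w
  | .inl true => 2 * w
  | .inr (.inl j) => w / (64 * (j + 1) ^ 2)
  | .inr (.inr j) => 64 * w * (j + 1) ^ 2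

/-- The product of the distances from a node to the others. -/
noncomputable def nodeDist (w n m : ℕ) (i : Bool ⊕ (Fin n ⊕ Fin m)) : ℝ :=
  ∏ j, if j = i then 1 else |(node w n m i : ℝ) - node w n m j|

theorem prod_large_le {w m : ℕ} (j : Fin m) :
    (∏ i : Fin m, if i = j then (1 : ℝ) else 64 * w * ((i : ℝ) + 1) ^ 2) ≤
      2 * ∏ i : Fin m, if i = j then (1 : ℝ) else
        |64 * w * ((j : ℝ) + 1) ^ 2 - 64 * w * ((i : ℝ) + 1) ^ 2| := by
  have h (f : Fin m → ℝ) : (∏ i : Fin m, if i = j then (1 : ℝ) else 64 * w * f i) =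
      (∏ i : Fin m, if i = j then (1 : ℝ) else 64 * w) * ∏ i, if i = j then 1 else f i := by
    rw [← Finset.prod_mul_distrib]
    exact Finset.prod_congr rfl fun i _ => by split_ifs <;> simp
  simp only [← mul_sub, abs_mul, Nat.abs_cast, Nat.abs_ofNat]
  rw [h, h, mul_left_comm]
  refine mul_le_mul_of_nonneg_left (prod_sq_le_two_mul_prod_sq_sub_sq j) ?_
  exact Finset.prod_nonneg fun i _ => by split_ifs <;> positivity

/-- Since `W/J² - W/I² = (W/J²) (I² - J²) / I²`, inverse squares reduce to squares. -/
theorem pow_le_prod_sub {n : ℕ} (W : ℝ) (hW : 0 < W) (j : Fin n) :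
    (∏ i : Fin n, if i = j then (1 : ℝ) else W / ((j : ℝ) + 1) ^ 2) ≤
      2 * ∏ i : Fin n, if i = j then (1 : ℝ) else
        |W / ((j : ℝ) + 1) ^ 2 - W / ((i : ℝ) + 1) ^ 2| := by
  have hpos : 0 < ∏ i : Fin n, if i = j then (1 : ℝ) else ((i : ℝ) + 1) ^ 2 :=
    Finset.prod_pos fun i _ => by split_ifs <;> positivity
  refine le_of_mul_le_mul_right ?_ hpos
  have h : (∏ i : Fin n, if i = j then (1 : ℝ) else
        |W / ((j : ℝ) + 1) ^ 2 - W / ((i : ℝ) + 1) ^ 2|) *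
      (∏ i : Fin n, if i = j then (1 : ℝ) else ((i : ℝ) + 1) ^ 2) =
      (∏ i : Fin n, if i = j then (1 : ℝ) else W / ((j : ℝ) + 1) ^ 2) *
      ∏ i : Fin n, if i = j then 1 else |((j : ℝ) + 1) ^ 2 - ((i : ℝ) + 1) ^ 2| := by
    rw [← Finset.prod_mul_distrib, ← Finset.prod_mul_distrib]
    refine Finset.prod_congr rfl fun i _ => ?_
    split_ifs
    · rfl
    · have h1 : W / ((j : ℝ) + 1) ^ 2 - W / ((i : ℝ) + 1) ^ 2 =
          -(W / ((j : ℝ) + 1) ^ 2 * (((j : ℝ) + 1) ^ 2 - ((i : ℝ) + 1) ^ 2)) /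
            ((i : ℝ) + 1) ^ 2 := by
        field_simp
        ring
      rw [h1, abs_div, abs_neg, abs_mul, abs_of_pos (by positivity : W / ((j : ℝ) + 1) ^ 2 > 0),
        abs_of_pos (by positivity : ((i : ℝ) + 1) ^ 2 > 0), div_mul_cancel₀ _ (by positivity)]
  rw [mul_assoc, h, mul_left_comm]
  refine mul_le_mul_of_nonneg_left (prod_sq_le_two_mul_prod_sq_sub_sq j) ?_
  exact Finset.prod_nonneg fun i _ => by split_ifs <;> positivity

/-- The difference is `W (a² - b²) / (a² b²) ≥ W / (a b²) ≥ W / n³`, which explains the fourth power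
of `n`. -/
theorem gap_inv_sq {n : ℕ} {a b : ℝ} (hb : 1 ≤ b) (hab : b + 1 ≤ a) (ha : a ≤ n) {W : ℝ} (hW : 2 * (n : ℝ) ^ 4 ≤ W) :
    2 * (n : ℝ) ≤ W / b ^ 2 - W / a ^ 2 := by
  have ha0 : 0 < a := by linarith
  have hb0 : 0 < b := by linarith
  have hn : (0 : ℝ) < n := by linarith
  rw [div_sub_div _ _ (by positivity) (by positivity), le_div_iff₀ (by positivity)]
  have h1 : a ≤ a ^ 2 - b ^ 2 := by nlinarith
  have h2 : b ^ 2 * a ≤ (n : ℝ) ^ 3 := by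
    have : b ≤ n := by linarith
    calc b ^ 2 * a ≤ (n : ℝ) ^ 2 * n := by gcongr
      _ = _ := by ring
  calc 2 * (n : ℝ) * (b ^ 2 * a ^ 2) = 2 * n * (b ^ 2 * a) * a := by ring
    _ ≤ 2 * n * (n : ℝ) ^ 3 * a := by gcongr
    _ = 2 * (n : ℝ) ^ 4 * a := by ring
    _ ≤ W * (a ^ 2 - b ^ 2) := mul_le_mul hW h1 ha0.le (le_trans (by positivity) hW)
    _ = _ := by ring

theorem gap_inv_sq_abs {n : ℕ} {W : ℝ} (hW : 2 * (n : ℝ) ^ 4 ≤ W) {i j : Fin n} (hij : i ≠ j) :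
    2 * (n : ℝ) ≤ |W / ((j : ℝ) + 1) ^ 2 - W / ((i : ℝ) + 1) ^ 2| := by
  have hi : (i : ℝ) + 1 ≤ n := by exact_mod_cast i.2
  have hj : (j : ℝ) + 1 ≤ n := by exact_mod_cast j.2
  rcases lt_or_gt_of_ne hij with h | h
  · have h' : (i : ℝ) + 1 ≤ j := by exact_mod_cast h
    rw [abs_sub_comm]
    exact (gap_inv_sq (by simp) (by linarith) hj hW).trans (le_abs_self _)
  · have h' : (j : ℝ) + 1 ≤ i := by exact_mod_cast h
    exact (gap_inv_sq (by simp) (by linarith) hi hW).trans (le_abs_self _)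

/-- Rounding shifts each difference by at most `1`, a relative loss of at most `1 / (2n)`; by
Bernoulli, `n` such losses cost at most a factor `2`. -/
theorem prod_sub_le_of_near {n : ℕ} {y z : Fin n → ℝ} (hzy : ∀ i, z i ≤ y i)
    (hyz : ∀ i, y i - 1 ≤ z i) (j : Fin n) (hgap : ∀ i, i ≠ j → 2 * (n : ℝ) ≤ |y j - y i|) :
    (∏ i, if i = j then (1 : ℝ) else |y j - y i|) ≤
      2 * ∏ i, if i = j then (1 : ℝ) else |z j - z i| := by
  have hn : (1 : ℝ) ≤ n := by exact_mod_cast j.pos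
  have hr : (0 : ℝ) ≤ 1 - 1 / (2 * n) := by
    rw [sub_nonneg, div_le_one (by positivity)]; linarith
  have h1 : (1 - 1 / (2 * (n : ℝ))) ^ n * (∏ i, if i = j then (1 : ℝ) else |y j - y i|) ≤
      ∏ i, if i = j then (1 : ℝ) else |z j - z i| := by
    have : (1 - 1 / (2 * (n : ℝ))) ^ n = ∏ _i : Fin n, (1 - 1 / (2 * (n : ℝ))) := by simp
    rw [this, ← Finset.prod_mul_distrib]
    refine Finset.prod_le_prod (fun i _ => by split_ifs <;> positivity) fun i _ => ?_
    split_ifs with h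
    · simp
    · have h2 := hgap i h
      have h3 : |y j - y i| ≤ |z j - z i| + 1 := by
        rw [abs_le]
        have := hzy i; have := hzy j; have := hyz i; have := hyz j
        constructor <;> cases abs_cases (z j - z i) <;> linarith
      have h4 : 1 ≤ 1 / (2 * (n : ℝ)) * |y j - y i| := by
        rw [one_div, ← div_eq_inv_mul, le_div_iff₀ (by positivity)]; linarith
      linarith
  have h2 : (1 : ℝ) / 2 ≤ (1 - 1 / (2 * (n : ℝ))) ^ n := by
    have := one_add_mul_le_pow (a := -(1 / (2 * (n : ℝ)))) (by linarith) n
    rw [← sub_eq_add_neg] at this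
    refine le_trans (le_of_eq ?_) this
    field_simp
    norm_num
  have h3 : 0 ≤ ∏ i, if i = j then (1 : ℝ) else |y j - y i| :=
    Finset.prod_nonneg fun i _ => by split_ifs <;> positivity
  nlinarith

theorem node_small_le (w j : ℕ) :
    ((w / (64 * (j + 1) ^ 2) : ℕ) : ℝ) ≤ (w / 64 : ℝ) / ((j : ℝ) + 1) ^ 2 := by
  refine Nat.cast_div_le.trans_eq ?_
  push_cast
  rw [div_div]

theorem le_node_small (w j : ℕ) :
    (w / 64 : ℝ) / ((j : ℝ) + 1) ^ 2 - 1 ≤ ((w / (64 * (j + 1) ^ 2) : ℕ) : ℝ) := by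
  have h : (w : ℝ) < (64 * (j + 1) ^ 2) * ((w / (64 * (j + 1) ^ 2) : ℕ) + 1) := by
    exact_mod_cast Nat.lt_mul_div_succ w (by positivity : 0 < 64 * (j + 1) ^ 2)
  rw [sub_le_iff_le_add, div_div, div_le_iff₀ (by positivity), mul_comm]
  exact h.le

theorem small_gap {w n : ℕ} (hw : 128 * n ^ 4 ≤ w) : 2 * (n : ℝ) ^ 4 ≤ (w / 64 : ℝ) := by
  have : (128 * n ^ 4 : ℝ) ≤ w := by exact_mod_cast hw
  linarith

theorem prod_small_le {w n : ℕ} (hw : 128 * n ^ 4 ≤ w) (hw1 : 1 ≤ w) (j : Fin n) :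
    ((w / 64 : ℝ) / ((j : ℝ) + 1) ^ 2) ^ n ≤ 4 * ((w / 64 : ℝ) / ((j : ℝ) + 1) ^ 2) *
      ∏ i : Fin n, if i = j then (1 : ℝ) else
        |((w / (64 * (j + 1) ^ 2) : ℕ) : ℝ) - ((w / (64 * (i + 1) ^ 2) : ℕ) : ℝ)| := by
  have hw0 : (0 : ℝ) < w := by exact_mod_cast hw1
  have h1 := prod_ite_one_mul (fun _ : Fin n => (w / 64 : ℝ) / ((j : ℝ) + 1) ^ 2) j
  have h2 := pow_le_prod_sub (w / 64 : ℝ) (by positivity) j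
  have h3 := prod_sub_le_of_near (fun i : Fin n => node_small_le w i)
    (fun i => le_node_small w i) j fun i hi => gap_inv_sq_abs (small_gap hw) hi
  rw [Finset.prod_const, Finset.card_univ, Fintype.card_fin] at h1
  have hy : 0 ≤ (w / 64 : ℝ) / ((j : ℝ) + 1) ^ 2 := by positivity
  rw [← h1]
  nlinarith

theorem node_small_pos {w n : ℕ} (hw : 128 * n ^ 4 ≤ w) (j : Fin n) :
    0 < w / (64 * ((j : ℕ) + 1) ^ 2) := by
  apply Nat.div_pos _ (by positivity)
  have h1 : ((j : ℕ) + 1) ^ 2 ≤ n ^ 4 :=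
    (Nat.pow_le_pow_left j.2 2).trans (Nat.pow_le_pow_right j.pos (by norm_num))
  omega

theorem node_small_ne {w n : ℕ} (hw : 128 * n ^ 4 ≤ w) {i j : Fin n} (hij : i ≠ j) :
    w / (64 * ((i : ℕ) + 1) ^ 2) ≠ w / (64 * ((j : ℕ) + 1) ^ 2) := by
  intro h
  have h1 := gap_inv_sq_abs (small_gap hw) hij
  have h2 := node_small_le w i
  have h3 := node_small_le w j
  have h4 := le_node_small w i
  have h5 := le_node_small w j
  rw [h] at h2 h4
  have hn : (1 : ℝ) ≤ n := by exact_mod_cast j.pos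
  have h6 := abs_le.2 (⟨by linarith, by linarith⟩ : -1 ≤ (w / 64 : ℝ) / ((j : ℝ) + 1) ^ 2 -
    (w / 64 : ℝ) / ((i : ℝ) + 1) ^ 2 ∧ (w / 64 : ℝ) / ((j : ℝ) + 1) ^ 2 -
    (w / 64 : ℝ) / ((i : ℝ) + 1) ^ 2 ≤ 1)
  linarith

theorem node_small_le_div (w j : ℕ) : w / (64 * (j + 1) ^ 2) ≤ w / 64 :=
  Nat.div_le_div_left (Nat.le_mul_of_pos_right _ (by positivity)) (by norm_num)

theorem le_node_large (w j : ℕ) : 64 * w ≤ 64 * w * (j + 1) ^ 2 :=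
  Nat.le_mul_of_pos_right _ (by positivity)

theorem node_injective {w n m : ℕ} (hw1 : 1 ≤ w) (hw : 128 * n ^ 4 ≤ w) :
    Function.Injective (node w n m) := by
  rintro ((_ | _) | (i | i)) ((_ | _) | (j | j)) h <;> simp only [node] at h
  case inr.inl.inr.inl =>
    by_contra hij
    exact node_small_ne hw (fun hij' => hij (by rw [hij'])) h
  case inr.inr.inr.inr =>
    have := Nat.pow_left_injective two_ne_zero (Nat.eq_of_mul_eq_mul_left (by omega) h)
    have hij : i = j := Fin.ext (by simpa using this)
    rw [hij]
  all_goals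
    try have hi1 := node_small_le_div w i
    try have hi2 := le_node_large w i
    try have hj1 := node_small_le_div w j
    try have hj2 := le_node_large w j
    first
    | rfl
    | omega

theorem node_pos {w n m : ℕ} (hw1 : 1 ≤ w) (hw : 128 * n ^ 4 ≤ w) (i) : 1 ≤ node w n m i := by
  rcases i with (_ | _) | (i | i) <;> simp only [node]
  · exact hw1
  · omega
  · exact node_small_pos hw i
  · have := le_node_large w i
    omega

theorem node_le {w n m N : ℕ} (h2w : 2 * w ≤ N) (hm : 64 * w * m ^ 2 ≤ N) (i) :
    node w n m i ≤ N := by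
  rcases i with (_ | _) | (i | i) <;> simp only [node]
  · omega
  · exact h2w
  · have := node_small_le_div w i
    omega
  · exact (Nat.mul_le_mul_left _ (Nat.pow_le_pow_left i.2 2)).trans hm

theorem nodeDist_pos {w n m : ℕ} (hw1 : 1 ≤ w) (hw : 128 * n ^ 4 ≤ w) (i) :
    0 < nodeDist w n m i := by
  refine Finset.prod_pos fun j _ => ?_
  split_ifs with h
  · exact one_pos
  · rw [abs_pos, sub_ne_zero]
    exact_mod_cast fun h' => h (node_injective hw1 hw h').symm

theorem nodeDist_inl (w n m : ℕ) (b : Bool) : nodeDist w n m (.inl b) = w *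
    ((∏ i : Fin n, |(node w n m (.inl b) : ℝ) - ((w / (64 * (i + 1) ^ 2) : ℕ) : ℝ)|) *
      ∏ i : Fin m, |(node w n m (.inl b) : ℝ) - 64 * w * ((i : ℝ) + 1) ^ 2|) := by
  have h : |(w : ℝ) - 2 * w| = w := by rw [abs_sub_comm, abs_of_nonneg] <;> ring_nf; positivity
  rw [nodeDist, Fintype.prod_sum_type, Fintype.prod_sum_type]
  congr 1
  · cases b
    · simp [node, h]
    · rw [abs_sub_comm] at h
      simp [node, h]
  · simp [node]

theorem nodeDist_small (w n m : ℕ) (j : Fin n) : nodeDist w n m (.inr (.inl j)) =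
    (|((w / (64 * (j + 1) ^ 2) : ℕ) : ℝ) - 2 * w| * |((w / (64 * (j + 1) ^ 2) : ℕ) : ℝ) - w|) *
    ((∏ i : Fin n, if i = j then (1 : ℝ) else
        |((w / (64 * (j + 1) ^ 2) : ℕ) : ℝ) - ((w / (64 * (i + 1) ^ 2) : ℕ) : ℝ)|) *
      ∏ i : Fin m, |((w / (64 * (j + 1) ^ 2) : ℕ) : ℝ) - 64 * w * ((i : ℝ) + 1) ^ 2|) := by
  rw [nodeDist, Fintype.prod_sum_type, Fintype.prod_sum_type]
  simp [node]

theorem nodeDist_large (w n m : ℕ) (j : Fin m) : nodeDist w n m (.inr (.inr j)) =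
    (|64 * w * ((j : ℝ) + 1) ^ 2 - 2 * w| * |64 * w * ((j : ℝ) + 1) ^ 2 - w|) *
    ((∏ i : Fin n, |64 * w * ((j : ℝ) + 1) ^ 2 - ((w / (64 * (i + 1) ^ 2) : ℕ) : ℝ)|) *
      ∏ i : Fin m, if i = j then (1 : ℝ) else
        |64 * w * ((j : ℝ) + 1) ^ 2 - 64 * w * ((i : ℝ) + 1) ^ 2|) := by
  rw [nodeDist, Fintype.prod_sum_type, Fintype.prod_sum_type]
  simp [node]

/-- Replacing the small node `z` by `w` only brings the large nodes closer, and the small nodes are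
within `w` of `w`. The power `z^n` is absorbed by the distances among the `n` small nodes, up to one
factor `4 w / (64 J)` that supplies the decay. -/
theorem node_small_weight_le {w n m : ℕ} (hw1 : 1 ≤ w) (hw : 128 * n ^ 4 ≤ w) (j : Fin n) :
    (node w n m (.inr (.inl j)) : ℝ) ^ n / nodeDist w n m (.inr (.inl j)) ≤
      3 / 64 * (((j : ℝ) + 1) ^ 2)⁻¹ * ((w : ℝ) ^ n / nodeDist w n m (.inl false)) := by
  have hw0 : (0 : ℝ) < w := by exact_mod_cast hw1
  have hd1 := nodeDist_pos (m := m) hw1 hw (.inr (.inl j))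
  have hd2 := nodeDist_pos (m := m) hw1 hw (.inl false)
  rw [← mul_div_assoc, div_le_div_iff₀ hd1 hd2]
  have hz (i : ℕ) : ((w / (64 * (i + 1) ^ 2) : ℕ) : ℝ) ≤ w / 64 :=
    (node_small_le w i).trans (div_le_self (by positivity) (by nlinarith [i.cast_nonneg (α := ℝ)]))
  have hL (i : ℕ) : (64 * w : ℝ) ≤ 64 * w * ((i : ℝ) + 1) ^ 2 :=
    le_mul_of_one_le_right (by positivity) (by nlinarith [i.cast_nonneg (α := ℝ)])
  rw [nodeDist_inl, nodeDist_small]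
  simp only [node]
  have hy := prod_small_le hw hw1 j
  have hzy := node_small_le w j
  have hzw := hz j
  set z : ℝ := ((w / (64 * ((j : ℕ) + 1) ^ 2) : ℕ) : ℝ) with hzdef
  have hz0 : 0 ≤ z := Nat.cast_nonneg _
  set J : ℝ := ((j : ℝ) + 1) ^ 2 with hJ
  have hJ0 : 0 < J := by positivity
  set P := ∏ i : Fin n, if i = j then (1 : ℝ) else
        |z - ((w / (64 * (i + 1) ^ 2) : ℕ) : ℝ)|
  have hP : 0 ≤ P := Finset.prod_nonneg fun i _ => by split_ifs <;> positivity
  have hA : (∏ i : Fin n, |(w : ℝ) - ((w / (64 * (i + 1) ^ 2) : ℕ) : ℝ)|) ≤ (w : ℝ) ^ n := by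
    have : (w : ℝ) ^ n = ∏ _i : Fin n, (w : ℝ) := by simp
    rw [this]
    refine Finset.prod_le_prod (fun i _ => abs_nonneg _) fun i _ => ?_
    rw [abs_of_nonneg (by linarith [hz i])]
    linarith [Nat.cast_nonneg (α := ℝ) (w / (64 * ((i : ℕ) + 1) ^ 2))]
  have hB : (∏ i : Fin m, |(w : ℝ) - 64 * w * ((i : ℝ) + 1) ^ 2|) ≤
      ∏ i : Fin m, |z - 64 * w * ((i : ℝ) + 1) ^ 2| := by
    refine Finset.prod_le_prod (fun i _ => abs_nonneg _) fun i _ => ?_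
    have := hL i
    rw [abs_of_nonpos (by linarith), abs_of_nonpos (by linarith)]
    linarith
  set A := ∏ i : Fin n, |(w : ℝ) - ((w / (64 * (i + 1) ^ 2) : ℕ) : ℝ)|
  set B := ∏ i : Fin m, |(w : ℝ) - 64 * w * ((i : ℝ) + 1) ^ 2|
  set B' := ∏ i : Fin m, |z - 64 * w * ((i : ℝ) + 1) ^ 2|
  have hA0 : 0 ≤ A := Finset.prod_nonneg fun i _ => abs_nonneg _
  have hB0 : 0 ≤ B := Finset.prod_nonneg fun i _ => abs_nonneg _
  have hB'0 : 0 ≤ B' := hB0.trans hB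
  rw [abs_of_nonpos (by linarith : z - 2 * w ≤ 0), abs_of_nonpos (by linarith : z - w ≤ 0)]
  have hzn : z ^ n ≤ 4 * (w / 64 / J) * P := (pow_le_pow_left₀ hz0 hzy n).trans hy
  have hq : 4 * (w / 64 / J) * w ≤ 3 / 64 * J⁻¹ * (-(z - 2 * w) * -(z - w)) := by
    have : 4 * (w : ℝ) * w ≤ 3 * (-(z - 2 * w) * -(z - w)) := by nlinarith
    calc 4 * (w / 64 / J) * w = J⁻¹ / 64 * (4 * (w : ℝ) * w) := by ring
      _ ≤ J⁻¹ / 64 * (3 * (-(z - 2 * w) * -(z - w))) := by gcongr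
      _ = _ := by ring
  calc z ^ n * (w * (A * B)) ≤ (4 * (w / 64 / J) * P) * (w * ((w : ℝ) ^ n * B')) := by gcongr
    _ = (4 * (w / 64 / J) * w) * (P * (w : ℝ) ^ n * B') := by ring
    _ ≤ (3 / 64 * J⁻¹ * (-(z - 2 * w) * -(z - w))) * (P * (w : ℝ) ^ n * B') := by gcongr
    _ = _ := by ring

/-- For the small nodes `z`, the ratio `x / (x - z)` decreases in `x`, so passing from `2w` to the
large node `L` does not increase that part of the weight. The distances from `2w` to the large nodes
are at most these nodes themselves, and `prod_large_le` compares their product with the distances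
from `L`. -/
theorem node_large_weight_le {w n m : ℕ} (hw1 : 1 ≤ w) (hw : 128 * n ^ 4 ≤ w) (j : Fin m) :
    (node w n m (.inr (.inr j)) : ℝ) ^ n / nodeDist w n m (.inr (.inr j)) ≤
      3 / 64 * (((j : ℝ) + 1) ^ 2)⁻¹ * ((2 * w : ℝ) ^ n / nodeDist w n m (.inl true)) := by
  have hw0 : (0 : ℝ) < w := by exact_mod_cast hw1
  have hd1 := nodeDist_pos (m := m) hw1 hw (.inr (.inr j))
  have hd2 := nodeDist_pos (m := m) hw1 hw (.inl true)
  rw [← mul_div_assoc, div_le_div_iff₀ hd1 hd2]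
  have hz (i : ℕ) : ((w / (64 * (i + 1) ^ 2) : ℕ) : ℝ) ≤ w / 64 :=
    (node_small_le w i).trans (div_le_self (by positivity) (by nlinarith [i.cast_nonneg (α := ℝ)]))
  have hL (i : ℕ) : (64 * w : ℝ) ≤ 64 * w * ((i : ℝ) + 1) ^ 2 :=
    le_mul_of_one_le_right (by positivity) (by nlinarith [i.cast_nonneg (α := ℝ)])
  rw [nodeDist_inl, nodeDist_large]
  simp only [node]
  push_cast
  have hD := prod_large_le (w := w) j
  have hLL := prod_ite_one_mul (fun i : Fin m => 64 * (w : ℝ) * ((i : ℝ) + 1) ^ 2) j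
  have hLj := hL j
  set J : ℝ := ((j : ℝ) + 1) ^ 2 with hJ
  have hJ0 : 0 < J := by positivity
  set L : ℝ := 64 * w * J with hLdef
  have hL0 : 0 < L := by positivity
  set D := ∏ i : Fin m, if i = j then (1 : ℝ) else |L - 64 * w * ((i : ℝ) + 1) ^ 2|
  set E := ∏ i : Fin m, if i = j then (1 : ℝ) else 64 * w * ((i : ℝ) + 1) ^ 2
  have hE : 0 ≤ E := Finset.prod_nonneg fun i _ => by split_ifs <;> positivity
  have hA : L ^ n * (∏ i : Fin n, |2 * (w : ℝ) - ((w / (64 * (i + 1) ^ 2) : ℕ) : ℝ)|) ≤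
      (2 * w : ℝ) ^ n * ∏ i : Fin n, |L - ((w / (64 * (i + 1) ^ 2) : ℕ) : ℝ)| := by
    have h1 (x : ℝ) : x ^ n = ∏ _i : Fin n, x := by simp
    rw [h1, h1, ← Finset.prod_mul_distrib, ← Finset.prod_mul_distrib]
    refine Finset.prod_le_prod (fun i _ => by positivity) fun i _ => ?_
    have h2 := hz i
    have h3 := Nat.cast_nonneg (α := ℝ) (w / (64 * ((i : ℕ) + 1) ^ 2))
    rw [abs_of_nonneg (by linarith), abs_of_nonneg (by linarith)]
    nlinarith
  have hB : (∏ i : Fin m, |2 * (w : ℝ) - 64 * w * ((i : ℝ) + 1) ^ 2|) ≤ E * L := by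
    rw [hLL]
    refine Finset.prod_le_prod (fun i _ => abs_nonneg _) fun i _ => ?_
    have := hL i
    rw [abs_of_nonpos (by linarith)]
    linarith
  set A := ∏ i : Fin n, |2 * (w : ℝ) - ((w / (64 * (i + 1) ^ 2) : ℕ) : ℝ)|
  set A' := ∏ i : Fin n, |L - ((w / (64 * (i + 1) ^ 2) : ℕ) : ℝ)|
  set B := ∏ i : Fin m, |2 * (w : ℝ) - 64 * w * ((i : ℝ) + 1) ^ 2|
  have hA'0 : 0 ≤ A' := Finset.prod_nonneg fun i _ => abs_nonneg _
  have hB0 : 0 ≤ B := Finset.prod_nonneg fun i _ => abs_nonneg _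
  have hD0 : 0 ≤ D := by linarith
  rw [abs_of_nonneg (by linarith : 0 ≤ L - 2 * w), abs_of_nonneg (by linarith : 0 ≤ L - w)]
  have hq : 2 * L * w ≤ 3 / 64 * J⁻¹ * ((L - 2 * w) * (L - w)) := by
    have h1 : 2 * L * L ≤ 3 * ((L - 2 * w) * (L - w)) := by nlinarith
    have h2 : (w : ℝ) = J⁻¹ / 64 * L := by rw [hLdef]; field_simp
    calc 2 * L * w = J⁻¹ / 64 * (2 * L * L) := by nth_rw 1 [h2]; ring
      _ ≤ J⁻¹ / 64 * (3 * ((L - 2 * w) * (L - w))) := by gcongr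
      _ = _ := by ring
  calc L ^ n * (w * (A * B)) = w * (L ^ n * A) * B := by ring
    _ ≤ w * ((2 * w : ℝ) ^ n * A') * ((2 * D) * L) := by
        refine mul_le_mul (by gcongr) (hB.trans (by gcongr)) hB0 (by positivity)
    _ = (2 * L * w) * ((2 * w : ℝ) ^ n * A' * D) := by ring
    _ ≤ (3 / 64 * J⁻¹ * ((L - 2 * w) * (L - w))) * ((2 * w : ℝ) ^ n * A' * D) := by gcongr
    _ = _ := by ring

/-- The signed version of `nodeDist`. -/
noncomputable def nodeProd (w n m : ℕ) (i : Bool ⊕ (Fin n ⊕ Fin m)) : ℝ :=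
  ∏ j ∈ Finset.univ.erase i, ((node w n m i : ℝ) - node w n m j)

theorem nodeProd_eq (w n m : ℕ) (i) : nodeProd w n m i =
    ∏ j, if j = i then 1 else ((node w n m i : ℝ) - node w n m j) := by
  rw [← Finset.mul_prod_erase _ _ (Finset.mem_univ i), if_pos rfl, one_mul]
  exact Finset.prod_congr rfl fun j hj => (if_neg (Finset.ne_of_mem_erase hj)).symm

theorem abs_nodeProd (w n m : ℕ) (i) : |nodeProd w n m i| = nodeDist w n m i := by
  rw [nodeProd_eq, nodeDist, Finset.abs_prod]
  exact Finset.prod_congr rfl fun j _ => by split_ifs <;> simp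

/-- Exactly the `m` large nodes lie above both `w` and `2w`, so the two signs differ only through
the factor comparing `w` with `2w`. -/
theorem nodeProd_inl (w n m : ℕ) (b : Bool) :
    nodeProd w n m (.inl b) = (-1) ^ m * (if b then 1 else -1) * nodeDist w n m (.inl b) := by
  have hw0 : (0 : ℝ) ≤ w := by positivity
  have hv : (w : ℝ) ≤ node w n m (.inl b) ∧ (node w n m (.inl b) : ℝ) ≤ 2 * w := by
    cases b <;> simp [node] <;> linarith
  have hz (i : ℕ) : ((w / (64 * (i + 1) ^ 2) : ℕ) : ℝ) ≤ w / 64 :=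
    (node_small_le w i).trans (div_le_self (by positivity) (by nlinarith [i.cast_nonneg (α := ℝ)]))
  have hL (i : ℕ) : (64 * w : ℝ) ≤ 64 * w * ((i : ℝ) + 1) ^ 2 :=
    le_mul_of_one_le_right (by positivity) (by nlinarith [i.cast_nonneg (α := ℝ)])
  have h1 : (∏ i : Fin n, |(node w n m (.inl b) : ℝ) - ((w / (64 * (i + 1) ^ 2) : ℕ) : ℝ)|) =
      ∏ i : Fin n, ((node w n m (.inl b) : ℝ) - ((w / (64 * (i + 1) ^ 2) : ℕ) : ℝ)) :=
    Finset.prod_congr rfl fun i _ => abs_of_nonneg (by linarith [hz i])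
  have h2 : (∏ i : Fin m, ((node w n m (.inl b) : ℝ) - 64 * w * ((i : ℝ) + 1) ^ 2)) =
      (-1) ^ m * ∏ i : Fin m, |(node w n m (.inl b) : ℝ) - 64 * w * ((i : ℝ) + 1) ^ 2| := by
    have : ((-1 : ℝ)) ^ m = ∏ _i : Fin m, (-1 : ℝ) := by simp
    rw [this, ← Finset.prod_mul_distrib]
    refine Finset.prod_congr rfl fun i _ => ?_
    rw [abs_of_nonpos (by linarith [hL i])]
    ring
  have h3 : nodeProd w n m (.inl b) = ((if b then 1 else -1) * w) *
      ((∏ i : Fin n, ((node w n m (.inl b) : ℝ) - ((w / (64 * (i + 1) ^ 2) : ℕ) : ℝ))) *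
      ∏ i : Fin m, ((node w n m (.inl b) : ℝ) - 64 * w * ((i : ℝ) + 1) ^ 2)) := by
    rw [nodeProd_eq, Fintype.prod_sum_type, Fintype.prod_sum_type]
    congr 1
    · cases b <;> simp [node] <;> ring
    · simp [node]
  rw [h3, nodeDist_inl, h1, h2]
  ring

/-! ### The vanishing divided difference and the lower bound -/

/-- A bounded function on `{1, …, N}` that is a Laurent polynomial of low degrees takes similar
values at `w` and `2 w`. -/
theorem not_separated_of_laurent {N w n T : ℕ} (hw1 : 1 ≤ w) (h2w : 2 * w ≤ N)
    (hw : 128 * n ^ 4 ≤ w) (hN : 64 * w * (n + 2 * T) ^ 2 ≤ N) {q : ℕ → ℝ} {P : Polynomial ℂ}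
    (hP : P.natDegree ≤ 2 * (n + T))
    (hPq : ∀ k : ℕ, 1 ≤ k → k ≤ N → P.eval (k : ℂ) = (k : ℂ) ^ n * (q k : ℂ))
    (hq0 : ∀ k, 1 ≤ k → k ≤ N → 0 ≤ q k) (hq1 : ∀ k, 1 ≤ k → k ≤ N → q k ≤ 1)
    (hqw : q w ≤ 1 / 3) (hq2w : 2 / 3 ≤ q (2 * w)) : False := by
  -- This makes the number of nodes two more than the degree bound, so the interpolated top
  -- coefficient is zero.
  set m := n + 2 * T with hm
  set v := node w n m
  have hvinj : Function.Injective (fun i => (v i : ℂ)) :=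
    Nat.cast_injective.comp (node_injective hw1 hw)
  have hcard : (Finset.univ : Finset (Bool ⊕ (Fin n ⊕ Fin m))).card = 2 * (n + T) + 1 + 1 := by
    simp [hm]; ring
  have hv1 (i) : 1 ≤ v i := node_pos hw1 hw i
  have hvN (i) : v i ≤ N := node_le h2w hN i
  let t : Bool ⊕ (Fin n ⊕ Fin m) → ℝ := fun i =>
    (v i : ℝ) ^ n * (q (v i) - 1 / 2) / nodeProd w n m i
  have hsum : ∑ i, t i = 0 := by
    -- Centering `q` at `1/2` costs no degree, because `X^n / 2` is within the bound.
    let P' : Polynomial ℂ := P - Polynomial.C (1 / 2) * Polynomial.X ^ n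
    have hP' : P'.natDegree ≤ 2 * (n + T) :=
      (Polynomial.natDegree_sub_le _ _).trans
        (max_le hP ((Polynomial.natDegree_C_mul_X_pow_le _ _).trans (by omega)))
    have h := Lagrange.coeff_eq_sum (s := Finset.univ) hvinj.injOn (P := P')
      (by
        rw [hcard]
        refine (Polynomial.degree_le_natDegree).trans_lt ?_
        exact_mod_cast (by omega : P'.natDegree < 2 * (n + T) + 1 + 1))
    rw [hcard, Polynomial.coeff_eq_zero_of_natDegree_lt (by omega)] at h
    apply Complex.ofReal_injective
    rw [Complex.ofReal_zero, h, Complex.ofReal_sum]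
    refine Finset.sum_congr rfl fun i _ => ?_
    simp only [t, P', Polynomial.eval_sub, hPq _ (hv1 i) (hvN i), nodeProd, Polynomial.eval_mul,
      Polynomial.eval_C, Polynomial.eval_pow, Polynomial.eval_X]
    push_cast
    congr 1
    ring
  have ht (i) : |t i| ≤ (v i : ℝ) ^ n / nodeDist w n m i / 2 := by
    have h1 : |q (v i) - 1 / 2| ≤ 1 / 2 := by
      rw [abs_le]
      constructor <;> linarith [hq0 _ (hv1 i) (hvN i), hq1 _ (hv1 i) (hvN i)]
    have := nodeDist_pos (m := m) hw1 hw i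
    rw [abs_div, abs_mul, abs_nodeProd, abs_of_nonneg (by positivity : (0 : ℝ) ≤ (v i : ℝ) ^ n)]
    calc (v i : ℝ) ^ n * |q (v i) - 1 / 2| / nodeDist w n m i
        ≤ (v i : ℝ) ^ n * (1 / 2) / nodeDist w n m i := by gcongr
      _ = _ := by ring
  set bw : ℝ := (w : ℝ) ^ n / nodeDist w n m (.inl false) with hbw
  set b2w : ℝ := (2 * w : ℝ) ^ n / nodeDist w n m (.inl true) with hb2w
  have hw0 : (0 : ℝ) < w := by exact_mod_cast hw1
  have hbw0 : 0 < bw := div_pos (by positivity) (nodeDist_pos hw1 hw _)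
  have hb2w0 : 0 < b2w := div_pos (by positivity) (nodeDist_pos hw1 hw _)
  have hsmall : |∑ j : Fin n, t (.inr (.inl j))| ≤ 3 / 64 * bw := by
    refine (Finset.abs_sum_le_sum_abs _ _).trans ?_
    calc ∑ j : Fin n, |t (.inr (.inl j))|
        ≤ ∑ j : Fin n, (((j : ℝ) + 1) ^ 2)⁻¹ * (3 / 128 * bw) := by
          refine Finset.sum_le_sum fun j _ => (ht _).trans ?_
          linarith [node_small_weight_le (m := m) hw1 hw j]
      _ = (∑ j : Fin n, (((j : ℝ) + 1) ^ 2)⁻¹) * (3 / 128 * bw) := by rw [Finset.sum_mul]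
      _ ≤ 2 * (3 / 128 * bw) := by gcongr; exact sum_inv_sq_le_two n
      _ = _ := by ring
  have hlarge : |∑ j : Fin m, t (.inr (.inr j))| ≤ 3 / 64 * b2w := by
    refine (Finset.abs_sum_le_sum_abs _ _).trans ?_
    calc ∑ j : Fin m, |t (.inr (.inr j))|
        ≤ ∑ j : Fin m, (((j : ℝ) + 1) ^ 2)⁻¹ * (3 / 128 * b2w) := by
          refine Finset.sum_le_sum fun j _ => (ht _).trans ?_
          linarith [node_large_weight_le (m := m) hw1 hw j]
      _ = (∑ j : Fin m, (((j : ℝ) + 1) ^ 2)⁻¹) * (3 / 128 * b2w) := by rw [Finset.sum_mul]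
      _ ≤ 2 * (3 / 128 * b2w) := by gcongr; exact sum_inv_sq_le_two m
      _ = _ := by ring
  rw [Fintype.sum_sum_type, Fintype.sum_sum_type, Fintype.sum_bool] at hsum
  have hsgn : ((-1 : ℝ) ^ m)⁻¹ = (-1) ^ m := by rw [← inv_pow, inv_neg_one]
  have htw : t (.inl false) = (-1) ^ m * (bw * (1 / 2 - q w)) := by
    simp only [t, v, nodeProd_inl, node, hbw, div_eq_mul_inv, mul_inv, hsgn]
    norm_num
    ring
  have ht2w : t (.inl true) = (-1) ^ m * (b2w * (q (2 * w) - 1 / 2)) := by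
    simp only [t, v, nodeProd_inl, node, hb2w, div_eq_mul_inv, mul_inv, hsgn]
    norm_num
    ring
  rw [htw, ht2w, ← mul_add] at hsum
  -- The margins `2/3 - 1/2` and `1/2 - 1/3` give `1/6` of each main weight, against `3/64` for the
  -- remaining terms.
  have hX : b2w * (1 / 6) + bw * (1 / 6) ≤ b2w * (q (2 * w) - 1 / 2) + bw * (1 / 2 - q w) := by
    gcongr <;> linarith
  rw [abs_le] at hsmall hlarge
  rcases neg_one_pow_eq_or ℝ m with h | h <;> rw [h] at hsum <;> linarith

theorem mainTheorem1 :
    ∃ c : ℝ, 0 < c ∧ ∀ N w R T : ℕ, 1 ≤ w → 2 * w ≤ N →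
      ∀ Q : QuantumAlgorithm N R T, Q.Decides w →
        c * Real.sqrt ((N : ℝ) / (w : ℝ)) ≤ (T : ℝ) ∨
          c * min ((w : ℝ) ^ ((1 : ℝ) / 4)) (Real.sqrt ((N : ℝ) / (w : ℝ))) ≤ (R : ℝ) := by
  -- With `s = √(N/w)`, `R, T < s/24` gives `8 (R + 2T) ≤ s`, and `24⁴ ≥ 128` leaves room in the
  -- other condition.
  refine ⟨1 / 24, by norm_num, fun N w R T hw1 h2w Q ⟨hf, ht⟩ => ?_⟩
  by_contra! hcon
  obtain ⟨hT, hR⟩ := hcon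
  have hw0 : (0 : ℝ) < w := by exact_mod_cast hw1
  have hR1 : 24 * (R : ℝ) ≤ (w : ℝ) ^ ((1 : ℝ) / 4) := by
    linarith [min_le_left ((w : ℝ) ^ ((1 : ℝ) / 4)) (Real.sqrt ((N : ℝ) / (w : ℝ)))]
  have hR2 : 24 * (R : ℝ) ≤ Real.sqrt ((N : ℝ) / (w : ℝ)) := by
    linarith [min_le_right ((w : ℝ) ^ ((1 : ℝ) / 4)) (Real.sqrt ((N : ℝ) / (w : ℝ)))]
  have hsmall : 128 * R ^ 4 ≤ w := by
    have h1 := pow_le_pow_left₀ (by positivity) hR1 4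
    rw [← Real.rpow_natCast ((w : ℝ) ^ _) 4, ← Real.rpow_mul hw0.le] at h1
    norm_num at h1
    have h2 : (128 * R ^ 4 : ℝ) ≤ w := by nlinarith [pow_nonneg (Nat.cast_nonneg (α := ℝ) R) 4]
    exact_mod_cast h2
  have hlarge : 64 * w * (R + 2 * T) ^ 2 ≤ N := by
    have h1 : 8 * ((R : ℝ) + 2 * T) ≤ Real.sqrt ((N : ℝ) / (w : ℝ)) := by linarith
    have h2 := pow_le_pow_left₀ (by positivity) h1 2
    rw [Real.sq_sqrt (by positivity), le_div_iff₀ hw0] at h2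
    have h3 : (64 * w * (R + 2 * T) ^ 2 : ℝ) ≤ N := by linarith
    exact_mod_cast h3
  obtain ⟨P, hP, hPq⟩ := Q.exists_polynomial_averageProb true
  refine not_separated_of_laurent hw1 h2w hsmall hlarge hP hPq
    (fun k _ _ => Q.averageProb_nonneg true k) (fun k hk hkN => ?_) ?_
    (Q.le_averageProb h2w ht)
  · linarith [Q.averageProb_nonneg false k, Q.averageProb_false_add_true hk hkN]
  · linarith [Q.le_averageProb (by omega : w ≤ N) hf,
      Q.averageProb_false_add_true hw1 (by omega)]
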